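/- All Banach spaces are over the same scalar field, $\mathbb{R}$ or $\mathbb{C}$. A Banach space $Y$ is finitely representable in a Banach space $W$ if for every $\varepsilon>0$ and every finite-dimensional subspace $A$ of $Y$ there are a subspace $B$ of $W$ and an isomorphism $u:A\to B$ with $\|u\|\,\|u^{-1}\|\le 1+\varepsilon$. For a Banach space $X$, let $X^{f}$ be the class of all Banach spaces $W$ such that each of $X$ and $W$ is finitely representable in the other. A Banach space $Z$ is algebraically closed in $X^{f}$, written $Z\in\mathcal{A}(X^{f})$, if for every $W\in X^{f}$ and every isometric embedding $i:Z\to W$ there is a projection of norm one from $W^{**}$ onto $i^{**}(Z^{**})$, where $i^{**}:Z^{**}\to W^{**}$ is the double adjoint of $i$. A Banach space $Z$ has the identity extension property in $X^{f}$, written $Z\in IEP(X^{f})$, if for every $W\in X^{f}$ and every isometric embedding $j:Z\to W$ there is a bounded linear operator $T:W\to Z^{**}$ with $\|T\|=1$ and $T\circ j=k_Z$, where $k_Z:Z\to Z^{**}$ is the canonical embedding (that is, the identity of $Z$ extends to an operator $W\to Z^{**}$ of norm one). Theorem. Let $X$ and $Z$ be Banach spaces. If $Z\in\mathcal{A}(X^{f})$,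 then $Z\in IEP(X^{f})$. -/

import Mathlib

set_option maxSynthPendingDepth 3

universe u

namespace BanachClass

/-- The double adjoint `u** : E** → F**` of a bounded operator `u : E → F`,
`(u** φ) f = φ (f ∘ u)`. -/
noncomputable def doubleAdjoint {𝕜 E F : Type*} [RCLike 𝕜]
    [NormedAddCommGroup E] [NormedSpace 𝕜 E] [NormedAddCommGroup F] [NormedSpace 𝕜 F]
    (u : E →L[𝕜] F) :
    StrongDual 𝕜 (StrongDual 𝕜 E) →L[𝕜] StrongDual 𝕜 (StrongDual 𝕜 F) :=
  ContinuousLinearMap.precomp 𝕜 (ContinuousLinearMap.precomp 𝕜 u)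

/-- `X` is finitely representable in `Y`: every finite-dimensional subspace of `X` is, for every
`ε > 0`, `(1 + ε)`-isomorphic to a subspace of `Y`. -/
def FinitelyRepresentable (𝕜 X Y : Type*) [RCLike 𝕜]
    [NormedAddCommGroup X] [NormedSpace 𝕜 X] [NormedAddCommGroup Y] [NormedSpace 𝕜 Y] : Prop :=
  ∀ ε : ℝ, 0 < ε → ∀ A : Submodule 𝕜 X, FiniteDimensional 𝕜 A →
    ∃ (B : Submodule 𝕜 Y) (u : A ≃L[𝕜] B),
      ‖(u : A →L[𝕜] B)‖ * ‖(u.symm : B →L[𝕜] A)‖ ≤ 1 + ε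

/-- `X` and `Y` are finitely equivalent. For Banach spaces this says that `Y` belongs to
the class `X^f`. -/
def FinitelyEquivalent (𝕜 X Y : Type*) [RCLike 𝕜]
    [NormedAddCommGroup X] [NormedSpace 𝕜 X] [NormedAddCommGroup Y] [NormedSpace 𝕜 Y] : Prop :=
  FinitelyRepresentable 𝕜 X Y ∧ FinitelyRepresentable 𝕜 Y X

/-- The subspace `M` of `V` is the range of a projection `P : V → V` of norm one. -/
def NormOneComplemented {𝕜 V : Type*} [RCLike 𝕜] [NormedAddCommGroup V] [NormedSpace 𝕜 V]
    (M : Submodule 𝕜 V) : Prop :=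
  ∃ P : V →L[𝕜] V, P.comp P = P ∧ P.range = M ∧ ‖P‖ = 1



/-- `E` is algebraically closed in the class `X^f`: for every Banach space `W` in `X^f` and every
isometric embedding `i : E → W`, the double adjoint `i** : E** → W**` maps `E**` onto a norm one
complemented subspace of `W**`. -/
def AlgebraicallyClosed (𝕜 : Type*) (X E : Type u) [RCLike 𝕜]
    [NormedAddCommGroup X] [NormedSpace 𝕜 X] [NormedAddCommGroup E] [NormedSpace 𝕜 E] : Prop :=
  ∀ (W : Type u) [NormedAddCommGroup W] [NormedSpace 𝕜 W] [CompleteSpace W],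
    FinitelyEquivalent 𝕜 X W → ∀ i : E →ₗᵢ[𝕜] W,
      NormOneComplemented (doubleAdjoint i.toContinuousLinearMap).range

/-- `Z` has the identity extension property in the class `X^f`: for every Banach space `W` in `X^f`
that contains `Z` as a subspace (through an isometric embedding `j : Z → W`), the identity of `Z`,
followed by the canonical embedding `Z → Z**`, extends to an operator `T : W → Z**` of norm one.
(If such a `W` exists then `Z` is automatically finitely representable in `X`.) -/
def IdentityExtensionProperty (𝕜 : Type*) (X Z : Type u) [RCLike 𝕜]
    [NormedAddCommGroup X] [NormedSpace 𝕜 X] [NormedAddCommGroup Z] [NormedSpace 𝕜 Z] : Prop :=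
  ∀ (W : Type u) [NormedAddCommGroup W] [NormedSpace 𝕜 W] [CompleteSpace W],
    FinitelyEquivalent 𝕜 X W → ∀ j : Z →ₗᵢ[𝕜] W,
      ∃ T : W →L[𝕜] StrongDual 𝕜 (StrongDual 𝕜 Z),
        ‖T‖ = 1 ∧ ∀ z : Z, T (j z) = NormedSpace.inclusionInDoubleDual 𝕜 Z z

end BanachClass

/-!
If `P` is a norm one projection of `W**` onto `j**(Z**)`, then `(j**)⁻¹ ∘ P` is a norm one left
inverse of the isometric embedding `j**`. Since `k_W ∘ j = j** ∘ k_Z`, the operator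
`(j**)⁻¹ ∘ P ∘ k_W : W → Z**` extends `k_Z`. Its norm is at most one, and at least one because
`‖P‖ = 1` forces `Z ≠ 0`.
-/

namespace BanachClass

section Precomposition

variable {𝕜 E F G : Type*} [NontriviallyNormedField 𝕜]
  [SeminormedAddCommGroup E] [NormedSpace 𝕜 E] [SeminormedAddCommGroup F] [NormedSpace 𝕜 F]
  [SeminormedAddCommGroup G] [NormedSpace 𝕜 G]

theorem norm_precomp_le (u : E →L[𝕜] F) :
    ‖(ContinuousLinearMap.precomp G u : (F →L[𝕜] G) →L[𝕜] E →L[𝕜] G)‖ ≤ ‖u‖ :=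
  ContinuousLinearMap.opNorm_le_bound _ (norm_nonneg u) fun f =>
    (f.opNorm_comp_le u).trans_eq (mul_comm _ _)

theorem one_le_norm_of_comp_linearIsometry_eq [NontrivialTopology E] {T : F →L[𝕜] G}
    {i : E →ₗᵢ[𝕜] F} {k : E →ₗᵢ[𝕜] G}
    (h : T.comp i.toContinuousLinearMap = k.toContinuousLinearMap) : 1 ≤ ‖T‖ :=
  calc
    1 = ‖T.comp i.toContinuousLinearMap‖ := by rw [h, k.norm_toContinuousLinearMap]
    _ ≤ ‖T‖ * ‖i.toContinuousLinearMap‖ := T.opNorm_comp_le _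
    _ = ‖T‖ := by rw [i.norm_toContinuousLinearMap, mul_one]

end Precomposition

section DoubleAdjoint

variable {𝕜 E F : Type*} [RCLike 𝕜]
  [NormedAddCommGroup E] [NormedSpace 𝕜 E] [NormedAddCommGroup F] [NormedSpace 𝕜 F]

theorem exists_strongDual_comp_eq_norm_eq (i : E →ₗᵢ[𝕜] F) (f : StrongDual 𝕜 E) :
    ∃ g : StrongDual 𝕜 F, g.comp i.toContinuousLinearMap = f ∧ ‖g‖ = ‖f‖ := by
  let e := i.equivRange
  obtain ⟨g, hg_extends, hg_norm⟩ := exists_extension_norm_eq (LinearMap.range i.toLinearMap)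
    (f.comp (e.symm.toContinuousLinearEquiv : _ →L[𝕜] E))
  refine ⟨g, ?_, hg_norm.trans (f.opNorm_comp_linearIsometryEquiv e.symm)⟩
  ext x
  calc
    g (e x) = f (e.symm (e x)) := hg_extends (e x)
    _ = f x := congrArg f (e.symm_apply_apply x)

theorem doubleAdjoint_inclusionInDoubleDual (u : E →L[𝕜] F) (x : E) :
    doubleAdjoint u (NormedSpace.inclusionInDoubleDual 𝕜 E x) =
      NormedSpace.inclusionInDoubleDual 𝕜 F (u x) :=
  rfl

theorem norm_doubleAdjoint_le (u : E →L[𝕜] F) : ‖doubleAdjoint u‖ ≤ ‖u‖ :=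
  (norm_precomp_le _).trans (norm_precomp_le u)

theorem norm_doubleAdjoint_apply (i : E →ₗᵢ[𝕜] F) (φ : StrongDual 𝕜 (StrongDual 𝕜 E)) :
    ‖doubleAdjoint i.toContinuousLinearMap φ‖ = ‖φ‖ := by
  apply le_antisymm
  · have hi : ‖doubleAdjoint i.toContinuousLinearMap‖ ≤ 1 :=
      (norm_doubleAdjoint_le _).trans i.norm_toContinuousLinearMap_le
    simpa only [one_mul] using ContinuousLinearMap.le_of_opNorm_le _ hi φ
  · refine φ.opNorm_le_bound (norm_nonneg _) fun f => ?_
    obtain ⟨g, rfl, hg⟩ := exists_strongDual_comp_eq_norm_eq i f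
    rw [← hg]
    exact (doubleAdjoint i.toContinuousLinearMap φ).le_opNorm g

/-- The double adjoint `i** : E** → F**` of an isometric embedding `i : E → F`, bundled as an
isometric embedding. -/
noncomputable def doubleAdjointIsometry (i : E →ₗᵢ[𝕜] F) :
    StrongDual 𝕜 (StrongDual 𝕜 E) →ₗᵢ[𝕜] StrongDual 𝕜 (StrongDual 𝕜 F) where
  toLinearMap := (doubleAdjoint i.toContinuousLinearMap).toLinearMap
  norm_map' := norm_doubleAdjoint_apply i

end DoubleAdjoint

namespace NormOneComplemented

variable {𝕜 E F : Type*} [RCLike 𝕜]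
  [NormedAddCommGroup E] [NormedSpace 𝕜 E] [NormedAddCommGroup F] [NormedSpace 𝕜 F]

theorem exists_leftInverse_norm_eq_one {i : E →ₗᵢ[𝕜] F}
    (h : NormOneComplemented (LinearMap.range i.toLinearMap)) :
    ∃ R : F →L[𝕜] E, ‖R‖ = 1 ∧ Function.LeftInverse R i := by
  obtain ⟨P, hP_idem, hP_range, hP_norm⟩ := h
  have hP_mem (y : F) : P y ∈ LinearMap.range i.toLinearMap :=
    hP_range ▸ LinearMap.mem_range_self P.toLinearMap y
  let R : F →L[𝕜] E :=
    (i.equivRange.symm.toContinuousLinearEquiv : _ →L[𝕜] E).comp (P.codRestrict _ hP_mem)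
  have hiR (y : F) : i (R y) = P y :=
    congrArg Subtype.val (i.equivRange.apply_symm_apply ⟨P y, hP_mem y⟩)
  have hP_fix (x : E) : P (i x) = i x := by
    obtain ⟨y, hy⟩ : i x ∈ P.range := hP_range ▸ LinearMap.mem_range_self i.toLinearMap x
    rw [← hy]
    exact DFunLike.congr_fun hP_idem y
  refine ⟨R, ?_, fun x => i.injective ((hiR (i x)).trans (hP_fix x))⟩
  calc
    ‖R‖ = ‖i.toContinuousLinearMap.comp R‖ := i.norm_toContinuousLinearMap_comp.symm
    _ = ‖P‖ := congrArg norm (ContinuousLinearMap.ext hiR)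
    _ = 1 := hP_norm

theorem exists_extension_inclusionInDoubleDual {i : E →ₗᵢ[𝕜] F}
    (h : NormOneComplemented (doubleAdjoint i.toContinuousLinearMap).range) :
    ∃ T : F →L[𝕜] StrongDual 𝕜 (StrongDual 𝕜 E),
      ‖T‖ = 1 ∧ ∀ x : E, T (i x) = NormedSpace.inclusionInDoubleDual 𝕜 E x := by
  obtain ⟨R, hR_norm, hR⟩ :=
    exists_leftInverse_norm_eq_one (i := doubleAdjointIsometry i) h
  let T := R.comp (NormedSpace.inclusionInDoubleDual 𝕜 F)
  have hT (x : E) : T (i x) = NormedSpace.inclusionInDoubleDual 𝕜 E x :=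
    calc
      T (i x) = R (doubleAdjoint i.toContinuousLinearMap
          (NormedSpace.inclusionInDoubleDual 𝕜 E x)) :=
        congrArg R (doubleAdjoint_inclusionInDoubleDual i.toContinuousLinearMap x).symm
      _ = NormedSpace.inclusionInDoubleDual 𝕜 E x := hR _
  have hT_le : ‖T‖ ≤ 1 :=
    calc
      ‖T‖ ≤ ‖R‖ * ‖NormedSpace.inclusionInDoubleDual 𝕜 F‖ := R.opNorm_comp_le _
      _ ≤ 1 := by
        rw [hR_norm, one_mul]
        exact NormedSpace.inclusionInDoubleDual_norm_le 𝕜 F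
  have : Nontrivial E := by
    by_contra! _
    simp [Subsingleton.elim R 0] at hR_norm
  have hT_ge : 1 ≤ ‖T‖ :=
    one_le_norm_of_comp_linearIsometry_eq (i := i) (k := NormedSpace.inclusionInDoubleDualLi 𝕜)
      (ContinuousLinearMap.ext hT)
  exact ⟨T, hT_le.antisymm hT_ge, hT⟩

end NormOneComplemented

end BanachClass

theorem theorem4_general {𝕜 : Type*} [RCLike 𝕜] {X Z : Type u}
    [NormedAddCommGroup X] [NormedSpace 𝕜 X] [NormedAddCommGroup Z] [NormedSpace 𝕜 Z]
    (hZ : BanachClass.AlgebraicallyClosed 𝕜 X Z) :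
    BanachClass.IdentityExtensionProperty 𝕜 X Z :=
  fun W _ _ _ hW j => (hZ W hW j).exists_extension_inclusionInDoubleDual

theorem theorem4 {𝕜 : Type*} [RCLike 𝕜] (X Z : Type u)
    [NormedAddCommGroup X] [NormedSpace 𝕜 X] [CompleteSpace X]
    [NormedAddCommGroup Z] [NormedSpace 𝕜 Z] [CompleteSpace Z]
    (hZ : BanachClass.AlgebraicallyClosed 𝕜 X Z) :
    BanachClass.IdentityExtensionProperty 𝕜 X Z :=
  theorem4_general hZ
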